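/- Let $P=[0,1]^2$ be the unit square in the Euclidean plane, with boundary $\partial P$. For an integer $n\ge 1$ define $$\mathrm{Disp}(n;P)=\max_{X_1,\dots,X_n\in P}\ \min\Big(\{\operatorname{dist}(X_i,\partial P): 1\le i\le n\}\cup\{\|X_i-X_j\|_2: 1\le i,j\le n,\ i\ne j\}\Big),$$ where all distances are Euclidean; this maximum is attained. Then for every $n\ge 1$, $$\frac{2}{5+\sqrt{2\sqrt{3}\,n}}\ \le\ \mathrm{Disp}(n;P)\ \le\ \frac{2}{2+\sqrt{2\sqrt{3}\,n}},$$ where the outer square root is taken of the product $2\cdot\sqrt{3}\cdot n$. -/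

import Mathlib

noncomputable section

/-- The plane region `[0, 1]²`, with the Euclidean (L²) metric of the ambient space. -/
def unitSquare : Set (EuclideanSpace ℝ (Fin 2)) :=
  {x | ∀ i, x i ∈ Set.Icc (0 : ℝ) 1}

/-- All distances that matter for a configuration `X` of `n` points in the region `P`: the distance
of each point to the boundary of `P`, and the distance of each pair of distinctly indexed points. -/
def relevantDistances {k n : ℕ} (P : Set (EuclideanSpace ℝ (Fin k)))
    (X : Fin n → EuclideanSpace ℝ (Fin k)) : Set ℝ :=
  {d | ∃ i, d = Metric.infDist (X i) (frontier P)} ∪ {d | ∃ i j, i ≠ j ∧ d = dist (X i) (X j)}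

/-- The minimum of the relevant distances (a finite set, nonempty for `1 ≤ n`). -/
def minDistance {k n : ℕ} (P : Set (EuclideanSpace ℝ (Fin k)))
    (X : Fin n → EuclideanSpace ℝ (Fin k)) : ℝ :=
  sInf (relevantDistances P X)

/-- The infimum of the relevant distances is a genuine minimum. -/
theorem isLeast_minDistance {k n : ℕ} (hn : 1 ≤ n) (P : Set (EuclideanSpace ℝ (Fin k)))
    (X : Fin n → EuclideanSpace ℝ (Fin k)) :
    IsLeast (relevantDistances P X) (minDistance P X) := by
  have hfin : (relevantDistances P X).Finite := by
    refine Set.Finite.union ?_ ?_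
    · refine (Set.finite_range fun i => Metric.infDist (X i) (frontier P)).subset ?_
      rintro d ⟨i, rfl⟩
      exact ⟨i, rfl⟩
    · refine (Set.finite_range fun q : Fin n × Fin n => dist (X q.1) (X q.2)).subset ?_
      rintro d ⟨i, j, -, rfl⟩
      exact ⟨(i, j), rfl⟩
  have hne : (relevantDistances P X).Nonempty := ⟨_, Or.inl ⟨⟨0, hn⟩, rfl⟩⟩
  exact ⟨hne.csInf_mem hfin, fun _ hd => csInf_le hfin.bddBelow hd⟩

/-- The objective values attained by the configurations of `n` points in `P`. -/
def dispersionValues (n k : ℕ) (P : Set (EuclideanSpace ℝ (Fin k))) : Set ℝ :=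
  {d | ∃ X : Fin n → EuclideanSpace ℝ (Fin k), (∀ i, X i ∈ P) ∧ d = minDistance P X}

/-- The optimal dispersion value of `n` points in `P`. -/
def Disp (n : ℕ) {k : ℕ} (P : Set (EuclideanSpace ℝ (Fin k))) : ℝ :=
  sSup (dispersionValues n k P)

end

/-! Upper bound: if the minimum is `d > 0`, the disks of diameter `d` around the points pack the
concentric square of side `1 - d`. A Thue-type estimate, `card_mul_hexagon_le`, gives `n * (√3 / 2)
* d ^ 2 ≤ (1 - d) ^ 2`, which is the claim after taking square roots.

For that estimate, each Voronoi cell is truncated at `R = d / √3`, the circumradius of the regular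
hexagon around a disk of diameter `d`. What a neighbour removes from the disk of radius `R` is a
circular segment, inside a sector. The sectors of different neighbours are disjoint
(`disjoint_bisectorSector`), and each segment takes at most the share `segmentRatio` of its sector
(`volume_real_circularSegment_le`). Hence at least the area of the hexagon survives
(`le_volume_real_truncatedCell`). Mirror images of the centre in the sides count as neighbours,
which keeps the cells inside the square.

Lower bound: rows of a hexagonal lattice with spacing `d = 2 / (5 + S)`, `S = √(2√3 n)`, fit into
`[d, 1 - d]²`. -/

open MeasureTheory

/-! ### Areas of circular sectors and segments -/

/-- The circular sector of radius `R` around the positive real axis, whose half-angle has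
cosine `h`. -/
def circularSector (R h : ℝ) : Set ℂ := {z | ‖z‖ < R ∧ ‖z‖ * h < z.re}

/-- The circular segment cut off from the disk of radius `R` by the line `re z = R * h`. -/
def circularSegment (R h : ℝ) : Set ℂ := {z | ‖z‖ < R ∧ R * h ≤ z.re}

theorem measurableSet_circularSector (R h : ℝ) : MeasurableSet (circularSector R h) := by
  rw [circularSector, Set.ofPred_and]
  exact (measurableSet_lt (by fun_prop) (by fun_prop)).inter
    (measurableSet_lt (by fun_prop) (by fun_prop))

theorem measurableSet_circularSegment (R h : ℝ) : MeasurableSet (circularSegment R h) := by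
  rw [circularSegment, Set.ofPred_and]
  exact (measurableSet_lt (by fun_prop) (by fun_prop)).inter
    (measurableSet_le (by fun_prop) (by fun_prop))

theorem volume_circularSector {R α : ℝ} (hR : 0 ≤ R) (h0 : 0 ≤ α) (h1 : α ≤ Real.pi) :
    volume (circularSector R (Real.cos α)) = ENNReal.ofReal (R ^ 2 * α) := by
  have hms := measurableSet_circularSector R (Real.cos α)
  rw [← lintegral_indicator_one hms, ← Complex.lintegral_comp_polarCoord_symm]
  have key : ∀ p ∈ polarCoord.target,
      ENNReal.ofReal p.1 • (circularSector R (Real.cos α)).indicator (1 : ℂ → ENNReal)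
        (Complex.polarCoord.symm p) =
      (Set.Ioo 0 R ×ˢ Set.Ioo (-α) α).indicator (fun p => ENNReal.ofReal p.1 * 1) p := by
    rintro ⟨s, φ⟩ hp
    rw [polarCoord_target] at hp
    obtain ⟨hs, hφ⟩ := hp
    simp only [Set.mem_Ioi, Set.mem_Ioo] at hs hφ
    have hn : ‖(Complex.polarCoord.symm (s, φ) : ℂ)‖ = s := by
      rw [Complex.norm_polarCoord_symm, abs_of_pos hs]
    have hre : (Complex.polarCoord.symm (s, φ) : ℂ).re = s * Real.cos φ := by
      rw [Complex.polarCoord_symm_apply]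
      simp [Complex.cos_ofReal_re, Complex.sin_ofReal_im]
    have hcos : Real.cos α < Real.cos φ ↔ |φ| < α := by
      rw [← Real.cos_abs φ]
      exact Real.strictAntiOn_cos.lt_iff_gt ⟨h0, h1⟩
        ⟨abs_nonneg _, (abs_lt.2 hφ).le⟩
    have hiff : (Complex.polarCoord.symm (s, φ) : ℂ) ∈ circularSector R (Real.cos α) ↔
        ((s, φ) : ℝ × ℝ) ∈ Set.Ioo 0 R ×ˢ Set.Ioo (-α) α := by
      simp only [circularSector, Set.mem_ofPred_eq, hn, hre, Set.mem_prod, Set.mem_Ioo,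
        mul_lt_mul_iff_right₀ hs, hcos, abs_lt]
      tauto
    by_cases h : (Complex.polarCoord.symm (s, φ) : ℂ) ∈ circularSector R (Real.cos α)
    · rw [Set.indicator_of_mem h, Set.indicator_of_mem (hiff.1 h)]
      simp
    · rw [Set.indicator_of_notMem h, Set.indicator_of_notMem (fun h' => h (hiff.2 h'))]
      simp
  rw [setLIntegral_congr_fun polarCoord.open_target.measurableSet key,
    setLIntegral_indicator (measurableSet_Ioo.prod measurableSet_Ioo),
    Set.inter_eq_left.2, Measure.volume_eq_prod, ← Measure.prod_restrict,
    lintegral_prod_mul (f := ENNReal.ofReal) (g := fun _ => 1) (by fun_prop) (by fun_prop),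
    ← ofReal_integral_eq_lintegral_ofReal,
    ← integral_Ioc_eq_integral_Ioo, ← intervalIntegral.integral_of_le hR, integral_id,
    setLIntegral_one, Real.volume_Ioo, ← ENNReal.ofReal_mul (by nlinarith [sq_nonneg R])]
  · congr 1; ring
  · exact (continuous_id.integrableOn_Icc (a := 0) (b := R)).mono_set Set.Ioo_subset_Icc_self
  · exact (ae_restrict_iff' measurableSet_Ioo).2 (Filter.Eventually.of_forall fun x hx => hx.1.le)
  · rw [polarCoord_target]
    exact Set.prod_mono Set.Ioo_subset_Ioi_self (Set.Ioo_subset_Ioo (by linarith) h1)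

/-- The triangle that the line `re z = R * cos α` cuts off from a sector. -/
theorem volume_sector_triangle {R α : ℝ} (hR : 0 ≤ R) (h0 : 0 ≤ α) (h1 : α < Real.pi / 2) :
    volume {z : ℂ | z.re ∈ Set.Ioo 0 (R * Real.cos α) ∧
      z.im ∈ Set.Ioo (-(Real.tan α * z.re)) (Real.tan α * z.re)} =
      ENNReal.ofReal (R ^ 2 * (Real.sin α * Real.cos α)) := by
  have hc : 0 < Real.cos α := Real.cos_pos_of_mem_Ioo ⟨by linarith, h1⟩
  have ht : 0 ≤ Real.tan α := Real.tan_nonneg_of_nonneg_of_le_pi_div_two h0 h1.le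
  have hpre : {z : ℂ | z.re ∈ Set.Ioo 0 (R * Real.cos α) ∧
      z.im ∈ Set.Ioo (-(Real.tan α * z.re)) (Real.tan α * z.re)} =
      Complex.measurableEquivRealProd ⁻¹' regionBetween (fun x => -(Real.tan α * x))
        (fun x => Real.tan α * x) (Set.Ioo 0 (R * Real.cos α)) := rfl
  rw [hpre, Complex.volume_preserving_equiv_real_prod.measure_preimage_equiv,
    Measure.volume_eq_prod, volume_regionBetween_eq_integral]
  · congr 1
    rw [← integral_Ioc_eq_integral_Ioo, ← intervalIntegral.integral_of_le (by positivity)]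
    have : (fun y : ℝ => ((fun x => Real.tan α * x) - fun x => -(Real.tan α * x)) y) =
        fun y => (2 * Real.tan α) * y := by
      funext y; simp only [Pi.sub_apply]; ring
    rw [this, intervalIntegral.integral_const_mul, integral_id, Real.tan_eq_sin_div_cos]
    field_simp
    ring
  · exact ((by fun_prop : Continuous fun x => -(Real.tan α * x)).integrableOn_Icc).mono_set
      Set.Ioo_subset_Icc_self
  · exact ((by fun_prop : Continuous fun x => Real.tan α * x).integrableOn_Icc).mono_set
      Set.Ioo_subset_Icc_self
  · exact measurableSet_Ioo
  · intro x hx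
    have := mul_nonneg ht hx.1.le
    linarith

/-- The share of a sector with half-angle `π / 6` that its segment occupies. -/
noncomputable def segmentRatio : ℝ := 1 - 3 * Real.sqrt 3 / (2 * Real.pi)

/-- The right side is `sin (2α) / 2`, and concavity of the sine puts its graph above the chord over
`[0, π / 3]`. Equality holds at `α = π / 6`, the hexagon's half-angle. -/
theorem sqrt_three_mul_le_sin_mul_cos {α : ℝ} (h0 : 0 ≤ α) (h1 : α ≤ Real.pi / 6) :
    3 * Real.sqrt 3 / (2 * Real.pi) * α ≤ Real.sin α * Real.cos α := by
  have hpi := Real.pi_pos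
  have ha : 0 ≤ 1 - 6 * α / Real.pi := by rw [sub_nonneg, div_le_one hpi]; linarith
  have hb : 0 ≤ 6 * α / Real.pi := by positivity
  have hx : (0 : ℝ) ∈ Set.Icc 0 Real.pi := ⟨le_rfl, hpi.le⟩
  have hy : Real.pi / 3 ∈ Set.Icc 0 Real.pi := ⟨by positivity, by linarith⟩
  have hconc := strictConcaveOn_sin_Icc.concaveOn.2 hx hy ha hb (by ring)
  have harg : (1 - 6 * α / Real.pi) • (0 : ℝ) + (6 * α / Real.pi) • (Real.pi / 3) = 2 * α := by
    simp only [smul_eq_mul]; field_simp; ring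
  rw [harg, Real.sin_two_mul, Real.sin_zero, Real.sin_pi_div_three] at hconc
  simp only [smul_eq_mul] at hconc
  have : 3 * Real.sqrt 3 / (2 * Real.pi) * α = 6 * α / Real.pi * (Real.sqrt 3 / 2) / 2 := by
    field_simp; ring
  rw [this]
  linarith

theorem segmentRatio_nonneg : 0 ≤ segmentRatio := by
  have hpi := Real.pi_gt_three
  have h3 : Real.sqrt 3 ≤ 2 := Real.sqrt_le_iff.2 ⟨by norm_num, by norm_num⟩
  rw [segmentRatio, sub_nonneg, div_le_one (by positivity)]
  linarith

/-- For `h = cos α < 1` the segment and an open triangle of area `R² sin α cos α` are disjoint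
inside the sector of area `R² α`. The bound on `h` means `α ≤ π / 6`, where the triangle's share is
at least `1 - segmentRatio`. -/
theorem volume_real_circularSegment_le {R h : ℝ} (hR : 0 < R) (hh : Real.sqrt 3 / 2 ≤ h) :
    volume.real (circularSegment R h) ≤ segmentRatio * volume.real (circularSector R h) := by
  have hs3 : 0 < Real.sqrt 3 := Real.sqrt_pos.2 (by norm_num)
  rcases le_or_gt 1 h with h1 | h1
  · have : circularSegment R h = ∅ := by
      refine Set.eq_empty_of_forall_notMem fun z hz => ?_
      have := Complex.re_le_norm z
      nlinarith [hz.1, hz.2]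
    rw [this, measureReal_empty]
    exact mul_nonneg segmentRatio_nonneg measureReal_nonneg
  have hpos : 0 < h := by linarith
  set α := Real.arccos h with hα
  have hcos : Real.cos α = h := Real.cos_arccos (by linarith) h1.le
  have hα0 : 0 ≤ α := Real.arccos_nonneg h
  have hα6 : α ≤ Real.pi / 6 := by
    rw [← Real.arccos_cos (x := Real.pi / 6) (by positivity) (by linarith [Real.pi_pos]),
      Real.cos_pi_div_six]
    exact Real.arccos_le_arccos hh
  have hα2 : α < Real.pi / 2 := by linarith [Real.pi_pos]
  have hV := volume_circularSector hR.le hα0 (by linarith [Real.pi_pos])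
  have hT := volume_sector_triangle hR.le hα0 hα2
  rw [hcos] at hV
  set T := {z : ℂ | z.re ∈ Set.Ioo 0 (R * Real.cos α) ∧
      z.im ∈ Set.Ioo (-(Real.tan α * z.re)) (Real.tan α * z.re)} with hTdef
  have hdisj : Disjoint (circularSegment R h) T := by
    rw [Set.disjoint_left]
    rintro z ⟨-, hz⟩ ⟨⟨-, hz'⟩, -⟩
    rw [hcos] at hz'
    exact absurd hz' (not_lt.2 hz)
  have hsub : circularSegment R h ∪ T ⊆ circularSector R h := by
    rintro z (⟨hz, hz'⟩ | ⟨⟨hz0, hz1⟩, hz2, hz3⟩)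
    · exact ⟨hz, lt_of_lt_of_le (mul_lt_mul_of_pos_right hz hpos) hz'⟩
    · have hsq : z.im ^ 2 < (Real.tan α * z.re) ^ 2 := sq_lt_sq' hz2 hz3
      have hsc := Real.sin_sq_add_cos_sq α
      have htan : Real.tan α * h = Real.sin α := by
        rw [← hcos, Real.tan_mul_cos]
        rw [hcos]; exact hpos.ne'
      have hn : (‖z‖ * h) ^ 2 < z.re ^ 2 := by
        rw [mul_pow, Complex.sq_norm, Complex.normSq_apply]
        have : (Real.tan α * z.re) ^ 2 * h ^ 2 = (1 - h ^ 2) * z.re ^ 2 := by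
          rw [← mul_pow, mul_right_comm, htan, ← hcos]
          linear_combination z.re ^ 2 * hsc
        nlinarith [mul_lt_mul_of_pos_right hsq (pow_pos hpos 2)]
      have hlt : ‖z‖ * h < z.re := lt_of_pow_lt_pow_left₀ 2 hz0.le hn
      refine ⟨?_, hlt⟩
      rw [hcos] at hz1
      exact lt_of_mul_lt_mul_right (hlt.trans hz1) hpos.le
  have hfin : volume (circularSector R h) ≠ ⊤ := by rw [hV]; exact ENNReal.ofReal_ne_top
  have hTfin : volume T ≠ ⊤ := by rw [hT]; exact ENNReal.ofReal_ne_top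
  have hle := measureReal_mono hsub hfin
  rw [measureReal_union' hdisj (measurableSet_circularSegment R h)
    (ne_top_of_le_ne_top hfin (measure_mono (Set.subset_union_left.trans hsub))) hTfin] at hle
  have hsin := Real.sin_nonneg_of_nonneg_of_le_pi hα0 (by linarith [Real.pi_pos])
  have hcos0 : 0 ≤ Real.cos α := by rw [hcos]; exact hpos.le
  have hV' : volume.real (circularSector R h) = R ^ 2 * α := by
    rw [measureReal_def, hV, ENNReal.toReal_ofReal (by positivity)]
  have hT' : volume.real T = R ^ 2 * (Real.sin α * Real.cos α) := by
    rw [measureReal_def, hT, ENNReal.toReal_ofReal (by positivity)]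
  rw [hV'] at hle ⊢
  rw [hT'] at hle
  have := mul_le_mul_of_nonneg_left (sqrt_three_mul_le_sin_mul_cos hα0 hα6) (sq_nonneg R)
  rw [segmentRatio]
  linarith

/-! ### Segments and sectors determined by a neighbour -/

theorem exists_linearIsometryEquiv_apply_eq_norm (c : ℂ) :
    ∃ e : ℂ ≃ₗᵢ[ℝ] ℂ, e c = (‖c‖ : ℂ) := by
  rcases eq_or_ne c 0 with rfl | hc
  · exact ⟨LinearIsometryEquiv.refl ℝ ℂ, by simp⟩
  have hn : ‖c‖ ≠ 0 := norm_ne_zero_iff.2 hc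
  have hmem : (‖c‖ : ℂ) / c ∈ Submonoid.unitSphere ℂ := by
    rw [Submonoid.unitSphere]
    simp [hn]
  exact ⟨rotation (show Circle from ⟨(‖c‖ : ℂ) / c, hmem⟩),
    (rotation_apply _ _).trans (div_mul_cancel₀ _ hc)⟩

/-- The part of the disk of radius `R` around `0` that is at least as close to `c` as to `0`. -/
def bisectorSegment (R : ℝ) (c : ℂ) : Set ℂ := {z | ‖z‖ < R ∧ ‖z - c‖ ≤ ‖z‖}

/-- The sector of the disk of radius `R` around `0` spanned by the points of the bounding circle at
distance less than `R` from `c`. -/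
def bisectorSector (R : ℝ) (c : ℂ) : Set ℂ := {z | ‖z‖ < R ∧ ‖(R / ‖z‖) • z - c‖ < R}

theorem measurableSet_bisectorSegment (R : ℝ) (c : ℂ) :
    MeasurableSet (bisectorSegment R c) := by
  rw [bisectorSegment, Set.ofPred_and]
  exact (measurableSet_lt (by fun_prop) (by fun_prop)).inter
    (measurableSet_le (by fun_prop) (by fun_prop))

theorem measurableSet_bisectorSector (R : ℝ) (c : ℂ) :
    MeasurableSet (bisectorSector R c) := by
  rw [bisectorSector, Set.ofPred_and]
  exact (measurableSet_lt (by fun_prop) (by fun_prop)).inter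
    (measurableSet_lt (by fun_prop) (by fun_prop))

theorem norm_sub_ofReal_sq (w : ℂ) (x : ℝ) :
    ‖w - x‖ ^ 2 = ‖w‖ ^ 2 - 2 * x * w.re + x ^ 2 := by
  simp only [Complex.sq_norm, Complex.normSq_apply, Complex.sub_re, Complex.sub_im,
    Complex.ofReal_re, Complex.ofReal_im]
  ring

theorem volume_real_bisectorSegment {R : ℝ} (hR : 0 < R) {c : ℂ} (hc : 0 < ‖c‖) :
    volume.real (bisectorSegment R c) = volume.real (circularSegment R (‖c‖ / (2 * R))) := by
  obtain ⟨e, he⟩ := exists_linearIsometryEquiv_apply_eq_norm c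
  have hpre : bisectorSegment R c = e ⁻¹' circularSegment R (‖c‖ / (2 * R)) := by
    ext z
    simp only [bisectorSegment, circularSegment, Set.mem_preimage, Set.mem_ofPred_eq,
      LinearIsometryEquiv.norm_map, and_congr_right_iff]
    intro _
    rw [← pow_le_pow_iff_left₀ (norm_nonneg _) (norm_nonneg _) two_ne_zero,
      ← e.norm_map (z - c), map_sub, he, norm_sub_ofReal_sq, e.norm_map]
    have : R * (‖c‖ / (2 * R)) = ‖c‖ / 2 := by field_simp
    rw [this]
    constructor <;> intro h <;> nlinarith
  rw [hpre, measureReal_def, e.measurePreserving.measure_preimage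
    (measurableSet_circularSegment _ _).nullMeasurableSet, measureReal_def]

theorem volume_real_bisectorSector {R : ℝ} (hR : 0 < R) {c : ℂ} (hc : R ≤ ‖c‖) :
    volume.real (bisectorSector R c) = volume.real (circularSector R (‖c‖ / (2 * R))) := by
  obtain ⟨e, he⟩ := exists_linearIsometryEquiv_apply_eq_norm c
  have hpre : bisectorSector R c = e ⁻¹' circularSector R (‖c‖ / (2 * R)) := by
    ext z
    simp only [bisectorSector, circularSector, Set.mem_preimage, Set.mem_ofPred_eq,
      LinearIsometryEquiv.norm_map, and_congr_right_iff]
    intro _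
    -- At `z = 0` the quotient `R / ‖z‖` is `0`, so the left condition reads `‖c‖ < R`; it fails by
    -- `hc`, as does the right one.
    rcases eq_or_ne z 0 with rfl | hz
    · simp [hc]
    have hz' : 0 < ‖z‖ := norm_pos_iff.2 hz
    rw [← pow_lt_pow_iff_left₀ (norm_nonneg _) hR.le two_ne_zero,
      ← e.norm_map (_ - c), map_sub, he, norm_sub_ofReal_sq, e.norm_map, norm_smul,
      Real.norm_of_nonneg (by positivity), div_mul_cancel₀ _ hz'.ne', map_smul,
      Complex.real_smul, Complex.re_ofReal_mul]
    have hc0 : 0 < ‖c‖ := hR.trans_le hc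
    rw [← mul_div_assoc, div_lt_iff₀ (by positivity)]
    have h1 : R ^ 2 - 2 * ‖c‖ * (R / ‖z‖ * (e z).re) + ‖c‖ ^ 2 =
        R ^ 2 + (‖c‖ / ‖z‖) * (‖z‖ * ‖c‖ - (e z).re * (2 * R)) := by
      field_simp
      ring
    rw [h1]
    have hq : 0 < ‖c‖ / ‖z‖ := by positivity
    constructor <;> intro h
    · by_contra! h'
      nlinarith [mul_nonneg hq.le (sub_nonneg.2 h')]
    · nlinarith [mul_pos hq (sub_pos.2 h)]
  rw [hpre, measureReal_def, e.measurePreserving.measure_preimage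
    (measurableSet_circularSector _ _).nullMeasurableSet, measureReal_def]

theorem volume_real_bisectorSegment_le {R : ℝ} (hR : 0 < R) {c : ℂ}
    (hc : Real.sqrt 3 * R ≤ ‖c‖) :
    volume.real (bisectorSegment R c) ≤ segmentRatio * volume.real (bisectorSector R c) := by
  have hs : 1 ≤ Real.sqrt 3 := Real.one_le_sqrt.2 (by norm_num)
  have hc' : R ≤ ‖c‖ := (le_mul_of_one_le_left hR.le hs).trans hc
  rw [volume_real_bisectorSegment hR (hR.trans_le hc'), volume_real_bisectorSector hR hc']
  refine volume_real_circularSegment_le hR ?_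
  rw [div_le_div_iff₀ (by norm_num) (by positivity)]
  linarith

/-- Three points at pairwise distance at least `√3 * R` do not lie in a common disk of radius `R`,
unless all of them lie on its boundary. -/
theorem not_three_points_near {R : ℝ} (hR : 0 ≤ R) {x y w : ℂ} (hx : ‖x‖ ≤ R) (hy : ‖y‖ < R)
    (hw : ‖w‖ < R) (hxy : Real.sqrt 3 * R ≤ ‖x - y‖) (hxw : Real.sqrt 3 * R ≤ ‖x - w‖)
    (hyw : Real.sqrt 3 * R ≤ ‖y - w‖) : False := by
  have h3 : (Real.sqrt 3 * R) ^ 2 = 3 * R ^ 2 := by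
    rw [mul_pow, Real.sq_sqrt (by norm_num)]
  have h0 : 0 ≤ Real.sqrt 3 * R := by positivity
  have e1 := pow_le_pow_left₀ h0 hxy 2
  have e2 := pow_le_pow_left₀ h0 hxw 2
  have e3 := pow_le_pow_left₀ h0 hyw 2
  have e4 := pow_le_pow_left₀ (norm_nonneg _) hx 2
  have e5 := pow_lt_pow_left₀ hy (norm_nonneg _) two_ne_zero
  have e6 := pow_lt_pow_left₀ hw (norm_nonneg _) two_ne_zero
  have e7 := sq_nonneg ‖x + y + w‖
  -- By this identity the squared distances sum to at most `3 (‖x‖² + ‖y‖² + ‖w‖²) < 9 R²`, whereas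
  -- the separation forces at least `9 R²`.
  have key : ‖x - y‖ ^ 2 + ‖x - w‖ ^ 2 + ‖y - w‖ ^ 2 + ‖x + y + w‖ ^ 2 =
      3 * (‖x‖ ^ 2 + ‖y‖ ^ 2 + ‖w‖ ^ 2) := by
    simp only [Complex.sq_norm, Complex.normSq_apply, Complex.sub_re, Complex.sub_im,
      Complex.add_re, Complex.add_im]
    ring
  linarith

/-- Seen from the radial projection `p` of a common point, `a` and `b` are at distance less than `R`
and `0` at distance at most `R`. This contradicts `not_three_points_near`. -/
theorem disjoint_bisectorSector {R : ℝ} (hR : 0 < R) {a b : ℂ} (ha : Real.sqrt 3 * R ≤ ‖a‖)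
    (hb : Real.sqrt 3 * R ≤ ‖b‖) (hab : Real.sqrt 3 * R ≤ ‖a - b‖) :
    Disjoint (bisectorSector R a) (bisectorSector R b) := by
  rw [Set.disjoint_left]
  rintro z ⟨-, hza⟩ ⟨-, hzb⟩
  set p := (R / ‖z‖) • z with hp
  have hpR : ‖p‖ ≤ R := by
    rcases eq_or_ne z 0 with rfl | hz
    · simpa [hp] using hR.le
    · rw [hp, norm_smul, Real.norm_of_nonneg (by positivity),
        div_mul_cancel₀ _ (norm_ne_zero_iff.2 hz)]
  refine not_three_points_near hR.le hpR hza hzb ?_ ?_ ?_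
  · simpa using ha
  · simpa using hb
  · rwa [sub_sub_sub_cancel_left, norm_sub_rev]

/-! ### Truncated Voronoi cells -/

/-- The Voronoi cell of `0` with respect to the points `t k`, truncated at distance `R`. -/
def truncatedCell {ι : Type*} (R : ℝ) (t : ι → ℂ) : Set ℂ :=
  {z | ‖z‖ < R ∧ ∀ k, ‖z‖ < ‖z - t k‖}

theorem truncatedCell_eq {ι : Type*} (R : ℝ) (t : ι → ℂ) :
    truncatedCell R t = Metric.ball 0 R \ ⋃ k, bisectorSegment R (t k) := by
  ext z
  simp only [truncatedCell, bisectorSegment, Set.mem_ofPred_eq, Set.mem_sdiff, mem_ball_zero_iff,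
    Set.mem_iUnion, not_exists, not_and, not_le]
  exact and_congr_right fun h => forall_congr' fun k => ⟨fun h' _ => h', fun h' => h' h⟩

theorem measurableSet_truncatedCell {ι : Type*} [Finite ι] (R : ℝ) (t : ι → ℂ) :
    MeasurableSet (truncatedCell R t) := by
  rw [truncatedCell_eq]
  exact measurableSet_ball.diff (.iUnion fun k => measurableSet_bisectorSegment _ _)

theorem le_volume_real_truncatedCell {ι : Type*} [Fintype ι] {R : ℝ} (hR : 0 < R) {t : ι → ℂ}
    (h0 : ∀ k, Real.sqrt 3 * R ≤ ‖t k‖)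
    (hsep : Pairwise fun k l => Real.sqrt 3 * R ≤ ‖t k - t l‖) :
    3 * Real.sqrt 3 / 2 * R ^ 2 ≤ volume.real (truncatedCell R t) := by
  have hball : volume.real (Metric.ball (0 : ℂ) R) = Real.pi * R ^ 2 := by
    rw [measureReal_def, Complex.volume_ball, ENNReal.toReal_mul, ENNReal.toReal_pow,
      ENNReal.toReal_ofReal hR.le, mul_comm]
    rfl
  have hfin : volume (Metric.ball (0 : ℂ) R) ≠ ⊤ := measure_ball_lt_top.ne
  have hsub : ⋃ k, bisectorSegment R (t k) ⊆ Metric.ball 0 R :=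
    Set.iUnion_subset fun k z hz => mem_ball_zero_iff.2 hz.1
  have hsub' : ⋃ k, bisectorSector R (t k) ⊆ Metric.ball 0 R :=
    Set.iUnion_subset fun k z hz => mem_ball_zero_iff.2 hz.1
  rw [truncatedCell_eq, measureReal_sdiff hsub
    (.iUnion fun k => measurableSet_bisectorSegment _ _) hfin, hball]
  -- The segments may overlap; subadditivity suffices here. Only the sectors, whose areas must sum
  -- to at most that of the disk, need disjointness.
  have h1 : volume.real (⋃ k, bisectorSegment R (t k)) ≤
      ∑ k, volume.real (bisectorSegment R (t k)) := measureReal_iUnion_fintype_le _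
  have h2 : ∑ k, volume.real (bisectorSegment R (t k)) ≤
      segmentRatio * ∑ k, volume.real (bisectorSector R (t k)) := by
    rw [Finset.mul_sum]
    exact Finset.sum_le_sum fun k _ => volume_real_bisectorSegment_le hR (h0 k)
  have h3 : ∑ k, volume.real (bisectorSector R (t k)) =
      volume.real (⋃ k, bisectorSector R (t k)) :=
    (measureReal_iUnion_fintype (fun k l hkl => disjoint_bisectorSector hR (h0 k) (h0 l)
      (hsep hkl)) (fun k => measurableSet_bisectorSector _ _)
      (fun k => ne_top_of_le_ne_top hfin
        (measure_mono ((Set.subset_iUnion _ k).trans hsub')))).symm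
  have h4 := measureReal_mono hsub' hfin
  rw [hball, ← h3] at h4
  have h5 := mul_le_mul_of_nonneg_left h4 segmentRatio_nonneg
  have h6 : Real.pi * R ^ 2 - segmentRatio * (Real.pi * R ^ 2) =
      3 * Real.sqrt 3 / 2 * R ^ 2 := by
    rw [segmentRatio]
    have := Real.pi_pos
    field_simp
    ring
  linarith

/-! ### Mirror images and packing in a square -/

/-- The vectors from `c` to its mirror images in the four sides of the square `[0, s]²`. -/
def mirrorVector (s : ℝ) (c : ℂ) : Fin 4 → ℂ :=
  ![⟨-(2 * c.re), 0⟩, ⟨2 * (s - c.re), 0⟩, ⟨0, -(2 * c.im)⟩, ⟨0, 2 * (s - c.im)⟩]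

theorem le_norm_of_sq_le {d : ℝ} {z : ℂ} (h : d ^ 2 ≤ z.re ^ 2 + z.im ^ 2) : d ≤ ‖z‖ := by
  refine le_of_sq_le_sq ?_ (norm_nonneg _)
  rw [Complex.sq_norm, Complex.normSq_apply]
  linarith

theorem le_norm_mirrorVector {s d : ℝ} (hd : 0 ≤ d) {c : ℂ}
    (hre : c.re ∈ Set.Icc (d / 2) (s - d / 2)) (him : c.im ∈ Set.Icc (d / 2) (s - d / 2))
    (k : Fin 4) : d ≤ ‖mirrorVector s c k‖ := by
  obtain ⟨h1, h2⟩ := hre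
  obtain ⟨h3, h4⟩ := him
  refine le_norm_of_sq_le ?_
  fin_cases k <;> simp [mirrorVector] <;> nlinarith

theorem le_norm_mirrorVector_sub {s d : ℝ} (hd : 0 ≤ d) {c : ℂ}
    (hre : c.re ∈ Set.Icc (d / 2) (s - d / 2)) (him : c.im ∈ Set.Icc (d / 2) (s - d / 2))
    {k l : Fin 4} (hkl : k ≠ l) : d ≤ ‖mirrorVector s c k - mirrorVector s c l‖ := by
  obtain ⟨h1, h2⟩ := hre
  obtain ⟨h3, h4⟩ := him
  refine le_norm_of_sq_le ?_
  fin_cases k <;> fin_cases l <;> simp [mirrorVector] at hkl ⊢ <;> nlinarith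

/-- Replacing `c` by its mirror image in a side raises its squared distance to `c'` by four times
the product of the distances of `c` and `c'` to that side. -/
theorem le_norm_sub_mirrorVector {s d : ℝ} (hd : 0 ≤ d) {c c' : ℂ}
    (hre : c.re ∈ Set.Icc (d / 2) (s - d / 2)) (him : c.im ∈ Set.Icc (d / 2) (s - d / 2))
    (hre' : c'.re ∈ Set.Icc (d / 2) (s - d / 2)) (him' : c'.im ∈ Set.Icc (d / 2) (s - d / 2))
    (hcc : d ≤ ‖c' - c‖) (k : Fin 4) : d ≤ ‖(c' - c) - mirrorVector s c k‖ := by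
  obtain ⟨h1, h2⟩ := hre
  obtain ⟨h3, h4⟩ := him
  obtain ⟨h5, h6⟩ := hre'
  obtain ⟨h7, h8⟩ := him'
  have h := pow_le_pow_left₀ hd hcc 2
  rw [Complex.sq_norm, Complex.normSq_apply, Complex.sub_re, Complex.sub_im] at h
  have hx : 0 ≤ c.re := by linarith
  have hy : 0 ≤ c.im := by linarith
  have hx' : 0 ≤ c'.re := by linarith
  have hy' : 0 ≤ c'.im := by linarith
  have sx : 0 ≤ s - c.re := by linarith
  have sy : 0 ≤ s - c.im := by linarith
  have sx' : 0 ≤ s - c'.re := by linarith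
  have sy' : 0 ≤ s - c'.im := by linarith
  have p1 := mul_nonneg hx hx'
  have p2 := mul_nonneg sx sx'
  have p3 := mul_nonneg hy hy'
  have p4 := mul_nonneg sy sy'
  refine le_norm_of_sq_le ?_
  fin_cases k <;> simp [mirrorVector] <;> nlinarith

/-- The vectors from `c i` to the other points of the configuration and to its mirror images in the
sides of the square. -/
def neighbourVector {ι : Type*} (s : ℝ) (c : ι → ℂ) (i : ι) : {j // j ≠ i} ⊕ Fin 4 → ℂ :=
  Sum.elim (fun j => c j - c i) (mirrorVector s (c i))

/-- The truncated Voronoi cell of `c i`, in absolute position. -/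
def squareCell {ι : Type*} (R s : ℝ) (c : ι → ℂ) (i : ι) : Set ℂ :=
  (fun z => z - c i) ⁻¹' truncatedCell R (neighbourVector s c i)

theorem disjoint_squareCell {ι : Type*} (R s : ℝ) (c : ι → ℂ) {i j : ι} (hij : i ≠ j) :
    Disjoint (squareCell R s c i) (squareCell R s c j) := by
  rw [Set.disjoint_left]
  rintro z ⟨-, hi⟩ ⟨-, hj⟩
  have h1 := hi (Sum.inl ⟨j, hij.symm⟩)
  have h2 := hj (Sum.inl ⟨i, hij⟩)
  simp only [neighbourVector, Sum.elim_inl, sub_sub_sub_cancel_right] at h1 h2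
  exact lt_asymm h1 h2

/-- A point beyond a side is closer to the mirror image in that side than to the centre `c i`. -/
theorem squareCell_subset {ι : Type*} {R s d : ℝ} (hd : 0 < d) {c : ι → ℂ} {i : ι}
    (hre : (c i).re ∈ Set.Icc (d / 2) (s - d / 2))
    (him : (c i).im ∈ Set.Icc (d / 2) (s - d / 2)) :
    squareCell R s c i ⊆ Complex.measurableEquivRealProd ⁻¹' (Set.Icc 0 s ×ˢ Set.Icc 0 s) := by
  rintro z ⟨-, h⟩
  obtain ⟨h1, h2⟩ := hre
  obtain ⟨h3, h4⟩ := him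
  have key : ∀ k, ‖z - c i‖ ^ 2 < ‖z - c i - mirrorVector s (c i) k‖ ^ 2 := fun k =>
    pow_lt_pow_left₀ (h (Sum.inr k)) (norm_nonneg _) two_ne_zero
  have k0 := key 0
  have k1 := key 1
  have k2 := key 2
  have k3 := key 3
  simp [mirrorVector, Complex.sq_norm, Complex.normSq_apply] at k0 k1 k2 k3
  simp only [Set.mem_preimage, Complex.measurableEquivRealProd_apply, Set.mem_prod, Set.mem_Icc]
  have hx : 0 < (c i).re := by linarith
  have hy : 0 < (c i).im := by linarith
  have sx : 0 < s - (c i).re := by linarith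
  have sy : 0 < s - (c i).im := by linarith
  refine ⟨⟨?_, ?_⟩, ?_, ?_⟩ <;> by_contra! hneg
  · nlinarith [mul_pos hx (neg_pos.2 hneg)]
  · nlinarith [mul_pos sx (sub_pos.2 hneg)]
  · nlinarith [mul_pos hy (neg_pos.2 hneg)]
  · nlinarith [mul_pos sy (sub_pos.2 hneg)]

/-- Thue's theorem for a square: disjoint disks of diameter `d` in a square of side `s` take up, on
average, at least the area of a circumscribed regular hexagon each. -/
theorem card_mul_hexagon_le {ι : Type*} [Fintype ι] {s d : ℝ} (hd : 0 < d) (hs : 0 ≤ s)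
    {c : ι → ℂ} (hre : ∀ i, (c i).re ∈ Set.Icc (d / 2) (s - d / 2))
    (him : ∀ i, (c i).im ∈ Set.Icc (d / 2) (s - d / 2))
    (hsep : Pairwise fun i j => d ≤ ‖c i - c j‖) :
    Fintype.card ι * (Real.sqrt 3 / 2 * d ^ 2) ≤ s ^ 2 := by
  classical
  have h3 : 0 < Real.sqrt 3 := Real.sqrt_pos.2 (by norm_num)
  have h33 : Real.sqrt 3 ^ 2 = 3 := Real.sq_sqrt (by norm_num)
  set R := d / Real.sqrt 3 with hR
  have hRd : Real.sqrt 3 * R = d := mul_div_cancel₀ _ h3.ne'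
  have hmeas : ∀ i, MeasurableSet (squareCell R s c i) := fun i =>
    (measurableSet_truncatedCell _ _).preimage (by fun_prop)
  have hcell : ∀ i, Real.sqrt 3 / 2 * d ^ 2 ≤ volume.real (squareCell R s c i) := by
    intro i
    have hvol : volume.real (squareCell R s c i) =
        volume.real (truncatedCell R (neighbourVector s c i)) := by
      rw [measureReal_def, squareCell, (measurePreserving_sub_right volume (c i)).measure_preimage
        (measurableSet_truncatedCell _ _).nullMeasurableSet, measureReal_def]
    rw [hvol]
    have hdR : 3 * Real.sqrt 3 / 2 * R ^ 2 = Real.sqrt 3 / 2 * d ^ 2 := by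
      rw [hR, div_pow, h33]; ring
    rw [← hdR]
    refine le_volume_real_truncatedCell (div_pos hd h3) ?_ ?_ <;> rw [hRd]
    · rintro (⟨j, hj⟩ | k)
      · exact hsep hj
      · exact le_norm_mirrorVector hd.le (hre i) (him i) k
    · rintro (⟨j, hj⟩ | k) (⟨l, hl⟩ | m) hne
      · simp only [neighbourVector, Sum.elim_inl, sub_sub_sub_cancel_right]
        exact hsep fun h => hne (by simp [h])
      · exact le_norm_sub_mirrorVector hd.le (hre i) (him i) (hre j) (him j) (hsep hj) m
      · rw [norm_sub_rev]
        exact le_norm_sub_mirrorVector hd.le (hre i) (him i) (hre l) (him l) (hsep hl) k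
      · exact le_norm_mirrorVector_sub hd.le (hre i) (him i) fun h => hne (by rw [h])
  set Q : Set ℂ := Complex.measurableEquivRealProd ⁻¹' (Set.Icc 0 s ×ˢ Set.Icc 0 s) with hQ
  have hQvol : volume Q = ENNReal.ofReal (s ^ 2) := by
    rw [hQ, Complex.volume_preserving_equiv_real_prod.measure_preimage_equiv,
      Measure.volume_eq_prod, Measure.prod_prod, Real.volume_Icc, ← ENNReal.ofReal_mul (by linarith)]
    congr 1; ring
  have hfin : volume Q ≠ ⊤ := by rw [hQvol]; exact ENNReal.ofReal_ne_top
  have hsub : ∀ i, squareCell R s c i ⊆ Q := fun i => squareCell_subset hd (hre i) (him i)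
  calc Fintype.card ι * (Real.sqrt 3 / 2 * d ^ 2)
      = ∑ _i : ι, Real.sqrt 3 / 2 * d ^ 2 := by simp
    _ ≤ ∑ i, volume.real (squareCell R s c i) := Finset.sum_le_sum fun i _ => hcell i
    _ = volume.real (⋃ i, squareCell R s c i) :=
        (measureReal_iUnion_fintype (fun i j hij => disjoint_squareCell R s c hij) hmeas
          fun i => ne_top_of_le_ne_top hfin (measure_mono (hsub i))).symm
    _ ≤ volume.real Q := measureReal_mono (Set.iUnion_subset hsub) hfin
    _ = s ^ 2 := by rw [measureReal_def, hQvol, ENNReal.toReal_ofReal (sq_nonneg s)]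

/-! ### The unit square and attainment of the maximum -/

theorem isClosed_unitSquare : IsClosed unitSquare := by
  rw [unitSquare, Set.ofPred_forall]
  exact isClosed_iInter fun i => isClosed_Icc.preimage (by fun_prop)

theorem unitSquare_eq_preimage :
    unitSquare = (EuclideanSpace.equiv (Fin 2) ℝ).toHomeomorph ⁻¹'
      Set.univ.pi fun _ => Set.Icc (0 : ℝ) 1 := by
  ext x
  simp only [unitSquare, Set.mem_ofPred_eq, Set.mem_preimage, Set.mem_univ_pi]
  rfl

theorem isCompact_unitSquare : IsCompact unitSquare := by
  rw [unitSquare_eq_preimage, Homeomorph.isCompact_preimage]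
  exact isCompact_univ_pi fun _ => isCompact_Icc

theorem mem_interior_unitSquare {x : EuclideanSpace ℝ (Fin 2)} :
    x ∈ interior unitSquare ↔ ∀ i, x i ∈ Set.Ioo (0 : ℝ) 1 := by
  rw [unitSquare_eq_preimage, ← Homeomorph.preimage_interior, interior_pi_set Set.finite_univ]
  simp [Set.mem_pi]

theorem mem_frontier_unitSquare {x : EuclideanSpace ℝ (Fin 2)} :
    x ∈ frontier unitSquare ↔ x ∈ unitSquare ∧ ∃ i, x i = 0 ∨ x i = 1 := by
  rw [isClosed_unitSquare.frontier_eq, Set.mem_sdiff, mem_interior_unitSquare, not_forall]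
  refine and_congr_right fun hx => exists_congr fun i => ?_
  have := hx i
  rw [Set.mem_Icc] at this
  rw [Set.mem_Ioo, not_and_or, not_lt, not_lt]
  constructor
  · rintro (h | h)
    · exact Or.inl (le_antisymm h this.1)
    · exact Or.inr (le_antisymm this.2 h)
  · rintro (h | h)
    · exact Or.inl h.le
    · exact Or.inr h.ge

theorem exists_mem_frontier_unitSquare {x : EuclideanSpace ℝ (Fin 2)} (hx : x ∈ unitSquare)
    (i : Fin 2) {v : ℝ} (hv : v = 0 ∨ v = 1) :
    ∃ y ∈ frontier unitSquare, dist x y = |x i - v| := by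
  refine ⟨WithLp.toLp 2 (Function.update x.ofLp i v), ?_, ?_⟩
  · refine mem_frontier_unitSquare.2 ⟨fun j => ?_, i, ?_⟩
    · rcases eq_or_ne j i with rfl | hj
      · rcases hv with rfl | rfl <;> simp
      · simpa [hj] using hx j
    · simpa using hv
  · rw [EuclideanSpace.dist_eq, Finset.sum_eq_single i]
    · rw [Real.sqrt_sq dist_nonneg]
      simp [Real.dist_eq]
    · intro j _ hj
      simp [hj]
    · simp

theorem le_infDist_frontier_unitSquare {x : EuclideanSpace ℝ (Fin 2)} (hx : x ∈ unitSquare)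
    {d : ℝ} : d ≤ Metric.infDist x (frontier unitSquare) ↔ ∀ i, x i ∈ Set.Icc d (1 - d) := by
  obtain ⟨y, hy, -⟩ := exists_mem_frontier_unitSquare hx 0 (Or.inl rfl)
  rw [Metric.le_infDist ⟨y, hy⟩]
  constructor
  · intro h i
    obtain ⟨y, hy, hxy⟩ := exists_mem_frontier_unitSquare hx i (Or.inl rfl)
    obtain ⟨z, hz, hxz⟩ := exists_mem_frontier_unitSquare hx i (Or.inr rfl)
    have h0 := hxy ▸ h hy
    have h1 := hxz ▸ h hz
    rw [sub_zero, abs_of_nonneg (hx i).1] at h0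
    rw [abs_sub_comm, abs_of_nonneg (sub_nonneg.2 (hx i).2)] at h1
    exact ⟨h0, by linarith⟩
  · intro h y hy
    obtain ⟨-, i, hi⟩ := mem_frontier_unitSquare.1 hy
    have hle : |x i - y i| ≤ dist x y := by
      rw [EuclideanSpace.dist_eq, ← Real.dist_eq]
      refine Real.le_sqrt_of_sq_le ?_
      exact Finset.single_le_sum (f := fun i => dist (x.ofLp i) (y.ofLp i) ^ 2)
        (fun j _ => sq_nonneg _) (Finset.mem_univ i)
    refine le_trans ?_ hle
    obtain ⟨h1, h2⟩ := h i
    rcases hi with hi | hi <;> rw [hi, le_abs]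
    · left; linarith
    · right; linarith

theorem le_minDistance_unitSquare {n : ℕ} (hn : 1 ≤ n) {X : Fin n → EuclideanSpace ℝ (Fin 2)}
    (hX : ∀ i, X i ∈ unitSquare) {d : ℝ} :
    d ≤ minDistance unitSquare X ↔ (∀ i k, X i k ∈ Set.Icc d (1 - d)) ∧
      Pairwise fun i j => d ≤ dist (X i) (X j) := by
  have hleast := isLeast_minDistance hn unitSquare X
  constructor
  · intro h
    exact ⟨fun i => (le_infDist_frontier_unitSquare (hX i)).1
      (h.trans (hleast.2 (Or.inl ⟨i, rfl⟩))),
      fun i j hij => h.trans (hleast.2 (Or.inr ⟨i, j, hij, rfl⟩))⟩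
  · rintro ⟨h1, h2⟩
    rcases hleast.1 with ⟨i, hi⟩ | ⟨i, j, hij, h⟩
    · rw [hi]
      exact (le_infDist_frontier_unitSquare (hX i)).2 (h1 i)
    · rw [h]
      exact h2 hij

/-- The minimum is over a finite index type of continuous functions; continuity gives attainment
over configurations in a compact region. -/
theorem continuous_minDistance {k n : ℕ} (hn : 1 ≤ n) (P : Set (EuclideanSpace ℝ (Fin k))) :
    Continuous (minDistance (n := n) P) := by
  have : Nonempty (Fin n) := ⟨⟨0, hn⟩⟩
  let f : Fin n ⊕ {p : Fin n × Fin n // p.1 ≠ p.2} →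
      (Fin n → EuclideanSpace ℝ (Fin k)) → ℝ :=
    Sum.elim (fun i X => Metric.infDist (X i) (frontier P)) fun p X => dist (X p.1.1) (X p.1.2)
  have hf : ∀ p, Continuous (f p) := by
    rintro (i | p)
    · exact (Metric.continuous_infDist_pt _).comp (continuous_apply i)
    · exact (continuous_apply _).dist (continuous_apply _)
  have heq : minDistance P = fun X => Finset.univ.inf' Finset.univ_nonempty fun p => f p X := by
    funext X
    rw [Finset.inf'_univ_eq_ciInf, iInf, minDistance]
    congr 1
    ext d
    constructor
    · rintro (⟨i, rfl⟩ | ⟨i, j, hij, rfl⟩)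
      · exact ⟨Sum.inl i, rfl⟩
      · exact ⟨Sum.inr ⟨(i, j), hij⟩, rfl⟩
    · rintro ⟨i | ⟨p, hp⟩, rfl⟩
      · exact Or.inl ⟨i, rfl⟩
      · exact Or.inr ⟨p.1, p.2, hp, rfl⟩
  rw [heq]
  exact Continuous.finset_inf'_apply _ fun p _ => hf p

theorem isGreatest_Disp {k n : ℕ} (hn : 1 ≤ n) {P : Set (EuclideanSpace ℝ (Fin k))}
    (hP : IsCompact P) (hne : P.Nonempty) :
    IsGreatest (dispersionValues n k P) (Disp n P) := by
  have heq : dispersionValues n k P = minDistance P '' Set.univ.pi fun _ : Fin n => P := by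
    ext d
    constructor
    · rintro ⟨X, hX, rfl⟩
      exact ⟨X, fun i _ => hX i, rfl⟩
    · rintro ⟨X, hX, rfl⟩
      exact ⟨X, fun i => hX i trivial, rfl⟩
  have hcomp : IsCompact (dispersionValues n k P) := by
    rw [heq]
    exact (isCompact_univ_pi fun _ => hP).image (continuous_minDistance hn P)
  refine hcomp.isGreatest_sSup ?_
  obtain ⟨x, hx⟩ := hne
  exact ⟨_, fun _ => x, fun _ => hx, rfl⟩

/-! ### The upper bound -/

theorem dist_eq_norm_complex (x y : EuclideanSpace ℝ (Fin 2)) :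
    dist x y = ‖(⟨x 0, x 1⟩ - ⟨y 0, y 1⟩ : ℂ)‖ := by
  rw [EuclideanSpace.dist_eq, Fin.sum_univ_two, ← dist_eq_norm, Complex.dist_eq_re_im,
    Real.dist_eq, Real.dist_eq, sq_abs, sq_abs]

theorem Disp_unitSquare_le {n : ℕ} (hn : 1 ≤ n) :
    Disp n unitSquare ≤ 2 / (2 + Real.sqrt (2 * Real.sqrt 3 * (n : ℝ))) := by
  have hne : unitSquare.Nonempty := ⟨0, fun i => by simp⟩
  obtain ⟨⟨X, hX, hd⟩, -⟩ := isGreatest_Disp hn isCompact_unitSquare hne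
  set d := Disp n unitSquare with hdef
  set S := Real.sqrt (2 * Real.sqrt 3 * (n : ℝ)) with hS
  have hS0 : 0 ≤ S := Real.sqrt_nonneg _
  rcases le_or_gt d 0 with h0 | h0
  · exact h0.trans (by positivity)
  obtain ⟨h1, h2⟩ := (le_minDistance_unitSquare hn hX).1 hd.le
  have hd1 : d ≤ 1 := by
    have := h1 ⟨0, hn⟩ 0
    linarith [this.1, this.2]
  have hmem : ∀ i k, X i k - d / 2 ∈ Set.Icc (d / 2) ((1 - d) - d / 2) := fun i k =>
    ⟨by linarith [(h1 i k).1], by linarith [(h1 i k).2]⟩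
  -- Shifting both coordinates by `d / 2` moves the square `[d / 2, 1 - d / 2]²`, which contains the
  -- disks, to `[0, 1 - d]²`.
  have key := card_mul_hexagon_le (ι := Fin n) (s := 1 - d) h0 (by linarith)
    (c := fun i => ⟨X i 0 - d / 2, X i 1 - d / 2⟩) (fun i => hmem i 0) (fun i => hmem i 1) (by
      intro i j hij
      have : d ≤ dist (X i) (X j) := h2 hij
      rw [dist_eq_norm_complex] at this
      refine this.trans_eq ?_
      congr 1
      apply Complex.ext <;> simp)
  rw [Fintype.card_fin] at key
  have hS2 : S ^ 2 = 2 * Real.sqrt 3 * n := Real.sq_sqrt (by positivity)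
  have hle : S * d ≤ 2 * (1 - d) := by
    refine le_of_sq_le_sq ?_ (by linarith)
    rw [mul_pow, hS2]
    linarith
  rw [le_div_iff₀ (by positivity)]
  linarith

/-! ### Hexagonal arrangements and the lower bound -/

/-- Differences in the unit hexagonal lattice are `(a / 2, √3 b / 2)` with `a ≡ b` mod 2, of squared
length `(a² + 3 b²) / 4`. -/
theorem four_le_sq_add_three_mul_sq {a b : ℤ} (hpar : a % 2 = b % 2) (hne : a ≠ 0 ∨ b ≠ 0) :
    4 ≤ a ^ 2 + 3 * b ^ 2 := by
  rcases lt_trichotomy b 0 with hb | rfl | hb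
  · rcases eq_or_ne a 0 with rfl | ha
    · have : b ≤ -2 := by omega
      nlinarith
    · have : 0 < a ^ 2 := by positivity
      nlinarith
  · rcases lt_or_gt_of_ne (hne.resolve_right (by simp)) with ha | ha
    · have : a ≤ -2 := by omega
      nlinarith
    · have : 2 ≤ a := by omega
      nlinarith
  · rcases eq_or_ne a 0 with rfl | ha
    · have : 2 ≤ b := by omega
      nlinarith
    · have : 0 < a ^ 2 := by positivity
      nlinarith

/-- The `k`-th point of a hexagonal arrangement with nearest-neighbour distance `d` and `m` points
in each row. -/
noncomputable def hexagonalPoint (d : ℝ) (m k : ℕ) : EuclideanSpace ℝ (Fin 2) :=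
  -- Horizontal offsets count half-steps: odd rows are shifted by one. The leading `d` is the margin
  -- to the boundary.
  !₂[d + d * (((2 * (k % m) + k / m % 2 : ℕ) : ℝ) / 2),
    d + d * (Real.sqrt 3 / 2 * ((k / m : ℕ) : ℝ))]

theorem le_dist_hexagonalPoint (d : ℝ) {m k l : ℕ} (hkl : k ≠ l) :
    d ≤ dist (hexagonalPoint d m k) (hexagonalPoint d m l) := by
  rw [dist_eq_norm_complex]
  refine le_norm_of_sq_le ?_
  have hk := Nat.div_add_mod k m
  have hl := Nat.div_add_mod l m
  set a : ℤ := ((2 * (k % m) + k / m % 2 : ℕ) : ℤ) - ((2 * (l % m) + l / m % 2 : ℕ) : ℤ) with ha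
  set b : ℤ := ((k / m : ℕ) : ℤ) - ((l / m : ℕ) : ℤ) with hb
  have h4 : 4 ≤ a ^ 2 + 3 * b ^ 2 := by
    refine four_le_sq_add_three_mul_sq (by omega) ?_
    by_contra! h
    have hq : k / m = l / m := by omega
    have hr : k % m = l % m := by rw [hq] at ha; omega
    rw [hq, hr] at hk
    exact hkl (hk.symm.trans hl)
  have h4' : (4 : ℝ) ≤ (a : ℝ) ^ 2 + 3 * (b : ℝ) ^ 2 := by exact_mod_cast h4
  have h33 : Real.sqrt 3 ^ 2 = 3 := Real.sq_sqrt (by norm_num)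
  have ha' : (a : ℝ) =
      ((2 * (k % m) + k / m % 2 : ℕ) : ℝ) - ((2 * (l % m) + l / m % 2 : ℕ) : ℝ) := by
    rw [ha, Int.cast_sub, Int.cast_natCast, Int.cast_natCast]
  have hb' : (b : ℝ) = ((k / m : ℕ) : ℝ) - ((l / m : ℕ) : ℝ) := by
    rw [hb, Int.cast_sub, Int.cast_natCast, Int.cast_natCast]
  have hsum : (d * ((a : ℝ) / 2)) ^ 2 + (d * (Real.sqrt 3 / 2 * b)) ^ 2 =
      d ^ 2 * (((a : ℝ) ^ 2 + 3 * (b : ℝ) ^ 2) / 4) := by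
    linear_combination d ^ 2 * (b : ℝ) ^ 2 / 4 * h33
  have hle : d ^ 2 ≤ (d * ((a : ℝ) / 2)) ^ 2 + (d * (Real.sqrt 3 / 2 * b)) ^ 2 := by
    rw [hsum]
    exact le_mul_of_one_le_right (sq_nonneg d) (by linarith)
  refine hle.trans_eq ?_
  rw [ha', hb']
  simp only [hexagonalPoint, Complex.sub_re, Complex.sub_im, PiLp.toLp_apply, Matrix.cons_val_zero,
    Matrix.cons_val_one]
  ring

theorem le_Disp_unitSquare {n : ℕ} (hn : 1 ≤ n) :
    2 / (5 + Real.sqrt (2 * Real.sqrt 3 * (n : ℝ))) ≤ Disp n unitSquare := by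
  have hne : unitSquare.Nonempty := ⟨0, fun i => by simp⟩
  have hn' : (1 : ℝ) ≤ n := by exact_mod_cast hn
  have h3 : 0 < Real.sqrt 3 := Real.sqrt_pos.2 (by norm_num)
  have h33 : Real.sqrt 3 ^ 2 = 3 := Real.sq_sqrt (by norm_num)
  set S := Real.sqrt (2 * Real.sqrt 3 * (n : ℝ)) with hS
  have hS0 : 0 < S := Real.sqrt_pos.2 (by positivity)
  have hS2 : S ^ 2 = 2 * Real.sqrt 3 * n := Real.sq_sqrt (by positivity)
  set d := 2 / (5 + S) with hd
  have hd0 : 0 < d := by positivity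
  have hd1 : d * (5 + S) = 2 := div_mul_cancel₀ _ (by positivity)
  -- Small enough that the last column, with its half-step shift, is at offset at most `(S + 1) /
  -- 2`; large enough (`m > S / 2`) that the row offsets stay below `√3 n / S = S / 2`.
  set m := ⌊S / 2⌋₊ + 1 with hm
  have hmS : S / 2 < m := by rw [hm]; push_cast; exact Nat.lt_floor_add_one _
  -- The choice of `d` makes `1 - 2 d = d (S + 1) / 2`, the room left between the margins.
  have hbound : ∀ t : ℝ, 0 ≤ t → t ≤ (S + 1) / 2 → d + d * t ∈ Set.Icc d (1 - d) := by
    intro t ht0 ht1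
    have h1 := mul_nonneg hd0.le ht0
    have h2 := mul_le_mul_of_nonneg_left ht1 hd0.le
    exact ⟨by linarith, by linarith⟩
  have hcol : ∀ k : ℕ, ((2 * (k % m) + k / m % 2 : ℕ) : ℝ) / 2 ≤ (S + 1) / 2 := by
    intro k
    have h1 : k % m ≤ ⌊S / 2⌋₊ := Nat.lt_succ_iff.1 (Nat.mod_lt k (Nat.succ_pos _))
    have h2 : 2 * (k % m) + k / m % 2 ≤ 2 * ⌊S / 2⌋₊ + 1 := by omega
    have h3 : ((2 * (k % m) + k / m % 2 : ℕ) : ℝ) ≤ 2 * (⌊S / 2⌋₊ : ℝ) + 1 := by exact_mod_cast h2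
    have h4 := Nat.floor_le (by positivity : 0 ≤ S / 2)
    linarith
  have hrow : ∀ k < n, Real.sqrt 3 / 2 * ((k / m : ℕ) : ℝ) ≤ (S + 1) / 2 := by
    intro k hk
    have h1 : ((k / m : ℕ) : ℝ) * m ≤ n := by
      exact_mod_cast (Nat.div_mul_le_self k m).trans hk.le
    have h2 : ((k / m : ℕ) : ℝ) * (S / 2) ≤ n :=
      (mul_le_mul_of_nonneg_left hmS.le (Nat.cast_nonneg _)).trans h1
    have h5 : S * (Real.sqrt 3 * ((k / m : ℕ) : ℝ)) ≤ S * S := by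
      have := mul_le_mul_of_nonneg_left h2 (by positivity : 0 ≤ 2 * Real.sqrt 3)
      linarith
    have h6 := le_of_mul_le_mul_left h5 hS0
    linarith
  let X : Fin n → EuclideanSpace ℝ (Fin 2) := fun k => hexagonalPoint d m k
  have hmem : ∀ i k, X i k ∈ Set.Icc d (1 - d) := by
    intro i k
    fin_cases k
    · exact hbound _ (by positivity) (hcol i)
    · exact hbound _ (by positivity) (hrow i i.2)
  have hX : ∀ i, X i ∈ unitSquare := fun i k =>
    ⟨hd0.le.trans (hmem i k).1, (hmem i k).2.trans (by linarith)⟩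
  refine le_trans ?_ ((isGreatest_Disp hn isCompact_unitSquare hne).2 ⟨X, hX, rfl⟩)
  exact (le_minDistance_unitSquare hn hX).2 ⟨hmem, fun i j hij =>
    le_dist_hexagonalPoint d fun h => hij (Fin.ext h)⟩

/-- The first conjunct says that the maximum that defines `Disp n unitSquare` is attained. -/
theorem mainTheorem9 (n : ℕ) (hn : 1 ≤ n) :
    IsGreatest (dispersionValues n 2 unitSquare) (Disp n unitSquare) ∧
      2 / (5 + Real.sqrt (2 * Real.sqrt 3 * (n : ℝ))) ≤ Disp n unitSquare ∧
      Disp n unitSquare ≤ 2 / (2 + Real.sqrt (2 * Real.sqrt 3 * (n : ℝ))) :=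
  ⟨isGreatest_Disp hn isCompact_unitSquare ⟨0, fun i => by simp⟩, le_Disp_unitSquare hn,
    Disp_unitSquare_le hn⟩
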